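/- Let $m\ge 0$ be an integer and $\alpha>-1$ real. Let $$L_n^{(\alpha)}(x)=\frac{(\alpha+1)_n}{n!}\sum_{k=0}^n\frac{(-n)_k}{k!\,(\alpha+1)_k}x^k,\qquad (a)_k=a(a+1)\cdots(a+k-1),$$ be the Laguerre polynomials, and for integers $n_0\ge 0$ and $\boldsymbol n=(n_1,\dots,n_m)$ with all $n_j\ge 0$ put $$A^{(\alpha)}(n_0,\boldsymbol n)=(-1)^{\sum_{j=1}^m n_j}\int_0^\infty x^{n_0}\,\frac{x^\alpha e^{-x}}{\Gamma(\alpha+1)}\prod_{j=1}^m n_j!\,L_{n_j}^{(\alpha)}(x)\,dx .$$ These integrals converge absolutely, and the following hold. (i) As formal power series in $x_0,x_1,\dots,x_m$ over $\mathbb R$, $$\sum_{n_0,\dots,n_m\ge 0}A^{(\alpha)}(n_0,\boldsymbol n)\frac{x_0^{n_0}}{n_0!}\cdots\frac{x_m^{n_m}}{n_m!}=\Bigl[1-x_0\prod_{j=1}^m(1+x_j)-\sum_{k=2}^m(k-1)\,e_k(x_1,\dots,x_m)\Bigr]^{-\alpha-1},$$ where $e_k$ is the $k$-th elementary symmetric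 polynomial and, for a power series $F$ with constant term $1$ and $r\in\mathbb R$, $F^{r}=\sum_{k\ge 0}\binom{r}{k}(F-1)^k$. (ii) Let $S_0,S_1,\dots,S_m$ be disjoint sets (boxes) with $|S_j|=n_j$ for $0\le j\le m$, and let $\mathfrak S^*(\boldsymbol n)$ be the set of permutations $\pi$ of $S_0\cup\cdots\cup S_m$ such that $\pi(S_j)\cap S_j=\emptyset$ for $1\le j\le m$ (no condition on the elements of $S_0$). Then, for all $n_0,n_1,\dots,n_m\ge 0$, $$A^{(\alpha)}(n_0,\boldsymbol n)=\sum_{\pi\in\mathfrak S^*(\boldsymbol n)}(\alpha+1)^{\operatorname{cyc}(\pi)},$$ where $\operatorname{cyc}(\pi)$ is the number of cycles of $\pi$, fixed points included. -/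

import Mathlib

open Finset MeasureTheory
open scoped Nat

noncomputable section

/-- The Laguerre polynomial
`L_n^{(α)}(x) = (α+1)_n / n! * ∑_{k=0}^n (-n)_k / (k! (α+1)_k) * x^k`, where `(a)_k` is the
shifted factorial `a (a+1) ⋯ (a+k-1)`. -/
def laguerre (α : ℝ) (n : ℕ) : Polynomial ℝ :=
  Polynomial.C ((ascPochhammer ℝ n).eval (α + 1) / (n ! : ℝ)) *
    ∑ k ∈ Finset.range (n + 1),
      Polynomial.C ((ascPochhammer ℝ k).eval (-(n : ℝ)) /
        ((k ! : ℝ) * (ascPochhammer ℝ k).eval (α + 1))) * Polynomial.X ^ k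

/-- The integrand `x^{n₀} * (x^α e^{-x} / Γ(α+1)) * ∏_j n_j! L_{n_j}^{(α)}(x)`. -/
def laguerreIntegrand {m : ℕ} (α : ℝ) (n₀ : ℕ) (n : Fin m → ℕ) (x : ℝ) : ℝ :=
  x ^ n₀ * (x ^ α * Real.exp (-x) / Real.Gamma (α + 1)) *
    ∏ j, (((n j) ! : ℕ) : ℝ) * (laguerre α (n j)).eval x

/-- The number
`A^{(α)}(n₀, n) = (-1)^{∑ n_j} ∫_0^∞ x^{n₀} (x^α e^{-x} / Γ(α+1)) ∏_j n_j! L_{n_j}^{(α)}(x) dx`. -/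
def laguerreNumber {m : ℕ} (α : ℝ) (n₀ : ℕ) (n : Fin m → ℕ) : ℝ :=
  (-1) ^ (∑ j, n j) * ∫ x in Set.Ioi (0 : ℝ), laguerreIntegrand α n₀ n x

/-- The exponential generating function of a family `a (n₀, n)`, as a formal power series in
`x_0, x_1, …, x_m`:  `∑ a (n₀, n) (x_0^{n₀} / n₀!) ∏_j (x_j^{n_j} / n_j!)`.
The variable `x_0` has index `0` and `x_j` (`1 ≤ j ≤ m`) has index `Fin.succ`. -/
def expGenFun {m : ℕ} (a : ℕ → (Fin m → ℕ) → ℝ) : MvPowerSeries (Fin (m + 1)) ℝ :=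
  fun d => a (d 0) (fun j => d j.succ) / ∏ i, (((d i) ! : ℕ) : ℝ)

/-- For a formal power series `F` with constant term `1` and real `r`, the formal power
`F ^ r = ∑_k binom(r, k) (F - 1)^k`: the binomial series `(1 + t)^r` at `t = F - 1`. -/
def formalRpow {σ : Type*} (F : MvPowerSeries σ ℝ) (r : ℝ) : MvPowerSeries σ ℝ :=
  (PowerSeries.binomialSeries ℝ r).subst (F - 1)

/-- The polynomial `1 - x_0 ∏_{j=1}^m (1 + x_j) - ∑_{k=2}^m (k - 1) e_k(x_1, …, x_m)`, with `e_k`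
the `k`-th elementary symmetric polynomial. -/
def basePoly (m : ℕ) : MvPolynomial (Fin (m + 1)) ℝ :=
  1 - MvPolynomial.X 0 * ∏ j : Fin m, (1 + MvPolynomial.X j.succ) -
    ∑ k ∈ Finset.Icc 2 m,
      MvPolynomial.C ((k : ℝ) - 1) * MvPolynomial.rename Fin.succ (MvPolynomial.esymm (Fin m) ℝ k)

/-- The disjoint union `S_0 ∪ S_1 ∪ ⋯ ∪ S_m` of boxes with `|S_0| = n₀` and `|S_j| = n_j`; an
element is a pair of a box index and a position in that box. -/
abbrev Boxes {m : ℕ} (n₀ : ℕ) (n : Fin m → ℕ) : Type :=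
  (i : Fin (m + 1)) × Fin ((Fin.cons n₀ n : Fin (m + 1) → ℕ) i)

/-- The set of permutations of `S_0 ∪ ⋯ ∪ S_m` that move every element of `S_1, …, S_m` out of its
box; elements of `S_0` are unrestricted. -/
def restrictedPerms {m : ℕ} (n₀ : ℕ) (n : Fin m → ℕ) : Finset (Equiv.Perm (Boxes n₀ n)) :=
  Finset.univ.filter fun π => ∀ b : Boxes n₀ n, b.1 ≠ 0 → (π b).1 ≠ b.1

/-- The number of cycles of a permutation (fixed points count as cycles). -/
def cyc {β : Type*} (π : Equiv.Perm β) : ℕ :=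
  Nat.card (Quotient (Equiv.Perm.SameCycle.setoid π))

/-- The base polynomial has constant term `1`, so that its formal real powers are meaningful. -/
theorem hasSubst_basePoly (m : ℕ) :
    PowerSeries.HasSubst ((basePoly m : MvPowerSeries (Fin (m + 1)) ℝ) - 1) := by
  apply PowerSeries.HasSubst.of_constantCoeff_zero
  have h : MvPolynomial.constantCoeff (basePoly m) = 1 := by
    unfold basePoly
    simp only [map_sub, map_one, map_mul, MvPolynomial.constantCoeff_X, zero_mul, sub_zero,
      map_sum, MvPolynomial.constantCoeff_rename]
    rw [sub_eq_self]
    refine Finset.sum_eq_zero fun k hk => ?_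
    rw [MvPolynomial.esymm, map_sum]
    refine mul_eq_zero_of_right _ (Finset.sum_eq_zero fun s hs => ?_)
    rw [map_prod]
    have hc : s.card = k := (Finset.mem_powersetCard.1 hs).2
    obtain ⟨i, hi⟩ : s.Nonempty := by
      rw [← Finset.card_pos]
      have := (Finset.mem_Icc.1 hk).1
      omega
    exact Finset.prod_eq_zero hi (by simp)
  rw [map_sub, map_one, ← MvPowerSeries.coeff_zero_eq_constantCoeff_apply, MvPolynomial.coeff_coe,
    ← MvPolynomial.constantCoeff_eq, h, sub_self]

end

/-! Put `β = α + 1`. Gamma integrals turn both claims into statements about the functional `x^k ↦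
(β)_k` applied to products of signed Laguerre polynomials.

For the permutation sum, the boxes are colours and a point is marked if it must change colour.
Unmarking a point overcounts by the permutations sending it to its own colour. Contracting it there
leaves a permutation of the other points, with weight `β` if it was fixed and `1` for each other
point of its colour as image. The factor `β + a + n` (`a` unmarked, `n` other marked points of the
colour) is that of the recursion defining `signedLaguerre`; with nothing marked both sides are
`(β)_N`. This is `cycleSum_eq_momentFunctional`.

For the generating function, the three-term Laguerre relation gives a recurrence in each `n_j` that
fixes all values from those on the `x_0`-axis (`IsLaguerreRecurrence.ext`). The base polynomial `P`
satisfies `(1 + x_j)^2 ∂_j P = ∂_0 P + (1 + x_j) P`, so the coefficients of `P^N` obey the same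
recurrence with `β = -N`. Coefficients of `P^r` are polynomial in `r`, so this passes from natural
`N` to `r = -β`. -/

/-! ### Cycle counts when a point is inserted into a permutation -/

/-- A reflexive, symmetric and transitive relation that relates every `u` to `π u` contains the
relation of lying in the same cycle of `π`. -/
theorem sameCycle_induction {β : Type*} {π : Equiv.Perm β} {r : β → β → Prop}
    (hr : Equivalence r) (h : ∀ u, r u (π u)) {u v : β} (huv : π.SameCycle u v) : r u v := by
  obtain ⟨i, rfl⟩ := huv
  induction i using Int.induction_on with
  | zero => exact hr.refl _
  | succ k ih =>
    rw [add_comm, zpow_add, zpow_one, Equiv.Perm.mul_apply]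
    exact hr.trans ih (h _)
  | pred k ih =>
    have h1 := h ((π ^ (-(k : ℤ) - 1)) u)
    rw [← Equiv.Perm.mul_apply, ← zpow_one_add] at h1
    rw [show 1 + (-(k : ℤ) - 1) = -k by ring] at h1
    exact hr.trans ih (hr.symm h1)

theorem cyc_congr {β γ : Type*} (e : β ≃ γ) (π : Equiv.Perm β) : cyc (e.permCongr π) = cyc π := by
  refine (Nat.card_congr (Quotient.congr e fun a b => ?_)).symm
  constructor
  · intro h
    refine sameCycle_induction (r := fun a b => (e.permCongr π).SameCycle (e a) (e b))
      ⟨fun _ => .refl _ _, .symm, .trans⟩ (fun u => ?_) h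
    exact ⟨1, by simp⟩
  · intro h
    have := sameCycle_induction (r := fun a b => π.SameCycle (e.symm a) (e.symm b))
      ⟨fun _ => .refl _ _, .symm, .trans⟩ (fun u => ⟨1, by simp⟩) h
    rw [e.symm_apply_apply, e.symm_apply_apply] at this
    exact this

section Option

variable {V : Type*} [DecidableEq V]

theorem decomposeOption_symm_apply_none (i : Option V) (σ : Equiv.Perm V) :
    Equiv.Perm.decomposeOption.symm (i, σ) none = i := by
  simp

/-- `none` is spliced into a cycle just before `i`: whatever `σ` sent to `i` is rerouted through
`none`. -/
theorem decomposeOption_symm_apply_some (i : Option V) (σ : Equiv.Perm V) (x : V) :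
    Equiv.Perm.decomposeOption.symm (i, σ) (some x) =
      if i = some (σ x) then none else some (σ x) := by
  rcases i with _ | c
  · simp
  · simp only [Equiv.Perm.decomposeOption_symm_apply, Equiv.Perm.mul_apply,
      Equiv.optionCongr_apply, Option.map_some, Equiv.swap_apply_def]
    simp [eq_comm]

theorem cyc_decomposeOption_symm_none [Finite V] (σ : Equiv.Perm V) :
    cyc (Equiv.Perm.decomposeOption.symm (none, σ)) = cyc σ + 1 := by
  set π := Equiv.Perm.decomposeOption.symm (none, σ) with hπ
  have hn : π none = none := decomposeOption_symm_apply_none _ _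
  have hs : ∀ x, π (some x) = some (σ x) := fun x => by
    rw [hπ, decomposeOption_symm_apply_some]; simp
  have key : ∀ u v, π.SameCycle u v → Option.Rel σ.SameCycle u v := fun u v =>
    sameCycle_induction (r := Option.Rel σ.SameCycle)
      ⟨fun u => by cases u <;> constructor; exact .refl _ _,
        fun h => by cases h <;> constructor; exact .symm ‹_›,
        fun h h' => by cases h <;> cases h' <;> constructor; exact .trans ‹_› ‹_›⟩
      (fun u => by
        rcases u with _ | x
        · rw [hn]; constructor
        · rw [hs]; constructor; exact ⟨1, by simp⟩)
  have key' : ∀ x y, σ.SameCycle x y → π.SameCycle (some x) (some y) := fun x y =>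
    sameCycle_induction (r := fun x y => π.SameCycle (some x) (some y))
      ⟨fun _ => .refl _ _, .symm, .trans⟩ (fun u => ⟨1, by simp [hs]⟩)
  let f : Quotient (Equiv.Perm.SameCycle.setoid π) →
      Option (Quotient (Equiv.Perm.SameCycle.setoid σ)) :=
    Quotient.lift (fun u => u.map (Quotient.mk _)) (fun u v h => by
      have h1 := key u v h
      rcases u with _ | x <;> rcases v with _ | y
      · rfl
      · cases h1
      · cases h1
      · exact congrArg some (Quotient.sound (Option.rel_some_some.1 h1)))
  have hf : Function.Bijective f := by
    constructor
    · rintro ⟨_ | x⟩ ⟨_ | y⟩ h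
      · rfl
      · cases h
      · cases h
      · exact Quotient.sound (key' x y (Quotient.exact (Option.some.inj h)))
    · rintro (_ | x)
      · exact ⟨Quotient.mk _ none, rfl⟩
      · induction x using Quotient.inductionOn with
        | h x => exact ⟨Quotient.mk _ (some x), rfl⟩
  rw [cyc, Nat.card_congr (Equiv.ofBijective f hf), Finite.card_option, cyc]

/-- The new point joins the cycle of `c`, so replacing `none` by `c` matches the cycles bijectively.
-/
theorem cyc_decomposeOption_symm_some (c : V) (σ : Equiv.Perm V) :
    cyc (Equiv.Perm.decomposeOption.symm (some c, σ)) = cyc σ := by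
  set π := Equiv.Perm.decomposeOption.symm (some c, σ) with hπ
  have hn : π none = some c := decomposeOption_symm_apply_none _ _
  have hs : ∀ x, π (some x) = if c = σ x then none else some (σ x) := fun x => by
    rw [hπ, decomposeOption_symm_apply_some]; simp
  have key : ∀ u v, π.SameCycle u v → σ.SameCycle (u.getD c) (v.getD c) := fun u v =>
    sameCycle_induction (r := fun u v : Option V => σ.SameCycle (u.getD c) (v.getD c))
      ⟨fun _ => .refl _ _, .symm, .trans⟩
      (fun u => by
        rcases u with _ | x
        · rw [hn]; exact .refl _ _
        · rw [hs]
          refine ⟨1, ?_⟩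
          split_ifs with h
          · simp [h]
          · simp)
  have key' : ∀ x y, σ.SameCycle x y → π.SameCycle (some x) (some y) := fun x y =>
    sameCycle_induction (r := fun x y => π.SameCycle (some x) (some y))
      ⟨fun _ => .refl _ _, .symm, .trans⟩ (fun u => by
        by_cases h : c = σ u
        -- Two steps are needed here: `some u` goes to `none`, then to `some c`.
        · exact ⟨2, by simp [zpow_ofNat, pow_two, hs, h, hn]⟩
        · exact ⟨1, by simp [hs, h]⟩)
  have key'' : ∀ u, π.SameCycle u (some (u.getD c)) := by
    rintro (_ | x)
    · exact ⟨1, by simp [hn]⟩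
    · exact .refl _ _
  refine Nat.card_congr ⟨Quotient.map' (fun u => u.getD c) key, Quotient.map' some key', ?_, ?_⟩
  · rintro ⟨u⟩
    exact Quotient.sound (key'' u).symm
  · rintro ⟨u⟩
    rfl

end Option

/-! ### Cycle-weighted sums over colour-changing permutations -/

open Classical in
/-- The sum of `β ^ cyc π` over the permutations `π` of a coloured set that change the colour of
every marked element. -/
noncomputable def cycleSum {V ι : Type*} [Fintype V] (β : ℝ) (κ : V → ι) (U : V → Prop) : ℝ :=
  ∑ π : Equiv.Perm V, if ∀ b, U b → κ (π b) ≠ κ b then β ^ cyc π else 0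

section cycleSum

variable {V W ι : Type*} [Fintype V] [Fintype W] (β : ℝ)

theorem cycleSum_eq_sum [DecidableEq V] (κ : V → ι) (U : V → Prop)
    [∀ π : Equiv.Perm V, Decidable (∀ b, U b → κ (π b) ≠ κ b)] :
    cycleSum β κ U = ∑ π : Equiv.Perm V, if ∀ b, U b → κ (π b) ≠ κ b then β ^ cyc π else 0 := by
  unfold cycleSum
  congr!

theorem cycleSum_congr (e : V ≃ W) (κ : W → ι) (U : W → Prop) :
    cycleSum β (κ ∘ e) (U ∘ e) = cycleSum β κ U := by
  classical
  rw [cycleSum_eq_sum, cycleSum_eq_sum]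
  refine Fintype.sum_equiv e.permCongr _ _ fun π => ?_
  rw [cyc_congr]
  refine if_congr ?_ rfl rfl
  rw [← e.forall_congr_right (q := fun b => U b → κ (e.permCongr π b) ≠ κ b)]
  simp

/-- Contracting the element `none` of a coloured set, when it is mapped to its own colour. -/
theorem cycleSum_contract [DecidableEq V] (κ : Option V → ι) (U : V → Prop)
    [∀ π : Equiv.Perm (Option V), Decidable (κ (π none) = κ none ∧
        ∀ x, U x → κ (π (some x)) ≠ κ (some x))] :
    (∑ π : Equiv.Perm (Option V), if κ (π none) = κ none ∧
        ∀ x, U x → κ (π (some x)) ≠ κ (some x) then β ^ cyc π else 0) =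
      (β + Nat.card {x : V // κ (some x) = κ none}) * cycleSum β (κ ∘ some) U := by
  classical
  -- A point rerouted through `none` changes its image from `i` to `none`, which has the same
  -- colour, so its constraint is unaffected.
  have hcond : ∀ (i : Option V) (σ : Equiv.Perm V), κ i = κ none →
      ((∀ x, U x → κ (Equiv.Perm.decomposeOption.symm (i, σ) (some x)) ≠ κ (some x)) ↔
        ∀ x, U x → (κ ∘ some) (σ x) ≠ (κ ∘ some) x) := by
    intro i σ hi
    refine forall_congr' fun x => ?_
    rw [decomposeOption_symm_apply_some]
    split_ifs with h
    · rw [← hi, h]; rfl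
    · rfl
  rw [← Equiv.sum_comp Equiv.Perm.decomposeOption.symm, Fintype.sum_prod_type,
    Fintype.sum_option]
  have h1 : (∑ σ : Equiv.Perm V, if κ (Equiv.Perm.decomposeOption.symm (none, σ) none) = κ none ∧
        ∀ x, U x → κ (Equiv.Perm.decomposeOption.symm (none, σ) (some x)) ≠ κ (some x) then
        β ^ cyc (Equiv.Perm.decomposeOption.symm (none, σ)) else 0) =
      β * cycleSum β (κ ∘ some) U := by
    rw [cycleSum_eq_sum, mul_sum]
    refine sum_congr rfl fun σ _ => ?_
    rw [mul_ite, mul_zero, ← pow_succ', ← cyc_decomposeOption_symm_none]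
    refine if_congr ?_ rfl rfl
    rw [hcond none σ rfl, decomposeOption_symm_apply_none, and_iff_right rfl]
  have h2 : ∀ c : V, (∑ σ : Equiv.Perm V,
        if κ (Equiv.Perm.decomposeOption.symm (some c, σ) none) = κ none ∧
        ∀ x, U x → κ (Equiv.Perm.decomposeOption.symm (some c, σ) (some x)) ≠ κ (some x) then
        β ^ cyc (Equiv.Perm.decomposeOption.symm (some c, σ)) else 0) =
      if κ (some c) = κ none then cycleSum β (κ ∘ some) U else 0 := by
    intro c
    split_ifs with hc
    · rw [cycleSum_eq_sum]
      refine sum_congr rfl fun σ _ => ?_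
      rw [cyc_decomposeOption_symm_some]
      refine if_congr ?_ rfl rfl
      rw [hcond (some c) σ hc, decomposeOption_symm_apply_none, and_iff_right hc]
    · refine sum_eq_zero fun σ _ => if_neg ?_
      rw [decomposeOption_symm_apply_none]
      simp [hc]
  rw [h1, sum_congr rfl fun c _ => h2 c, ← sum_filter, sum_const, nsmul_eq_mul,
    Nat.card_eq_fintype_card, Fintype.card_subtype]
  ring

/-- Unmarking one element. -/
theorem cycleSum_option (κ : Option V → ι) (U : Option V → Prop) (h : U none) :
    cycleSum β κ U = cycleSum β κ (fun b => b ≠ none ∧ U b) -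
      (β + Nat.card {x : V // κ (some x) = κ none}) * cycleSum β (κ ∘ some) (U ∘ some) := by
  classical
  rw [← cycleSum_contract, cycleSum_eq_sum, cycleSum_eq_sum, ← sum_sub_distrib]
  refine sum_congr rfl fun π _ => ?_
  simp only [Option.forall, h, Function.comp]
  by_cases h1 : κ (π none) = κ none <;> simp [h1]

theorem cycleSum_unmarked (κ : V → ι) :
    cycleSum β κ (fun _ => False) = (ascPochhammer ℝ (Fintype.card V)).eval β := by
  classical
  -- Without marks the colours are irrelevant; a single colour makes the contraction condition
  -- vacuous, and each point contributes a factor `β + n`.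
  suffices ∀ (n : ℕ) (V : Type _) [Fintype V], Fintype.card V = n →
      cycleSum β (fun _ : V => ()) (fun _ => False) = (ascPochhammer ℝ n).eval β by
    rw [← this _ V rfl]; simp [cycleSum]
  intro n
  induction n with
  | zero =>
    intro V _ hV
    have := Fintype.card_eq_zero_iff.1 hV
    simp [cycleSum, cyc]
  | succ n ih =>
    intro V _ hV
    have : Nonempty V := Fintype.card_pos_iff.1 (by omega)
    obtain ⟨b⟩ := this
    have hc : Fintype.card {x // x ≠ b} = n := by
      have := Fintype.card_congr (Equiv.optionSubtypeNe b)
      rw [Fintype.card_option] at this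
      omega
    have h := cycleSum_contract β (fun _ : Option {x // x ≠ b} => ()) (fun _ => False)
    rw [← cycleSum_congr β (Equiv.optionSubtypeNe b), cycleSum_eq_sum]
    simp only [true_and, false_imp_iff, implies_true, if_true, Function.comp_def] at h ⊢
    rw [h, ih _ hc, ascPochhammer_succ_eval]
    simp [hc, mul_comm, -ne_eq]

end cycleSum

/-! ### Laguerre polynomials: recursion, three-term relation, explicit form -/

open Polynomial in
/-- The polynomials `(-1)^n n! x^a L_n^{(β + a - 1)}(x)`, by recursion on `n`. -/
noncomputable def signedLaguerre (β : ℝ) : ℕ → ℕ → Polynomial ℝ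
  | 0, a => X ^ a
  | n + 1, a => signedLaguerre β n (a + 1) - C (β + a + n) * signedLaguerre β n a

/-- The linear functional with `x^k ↦ (β)_k`. -/
noncomputable def momentFunctional (β : ℝ) : Polynomial ℝ →ₗ[ℝ] ℝ :=
  Polynomial.lsum fun k => LinearMap.toSpanSingleton ℝ ℝ ((ascPochhammer ℝ k).eval β)

theorem momentFunctional_monomial (β : ℝ) (k : ℕ) (c : ℝ) :
    momentFunctional β (Polynomial.monomial k c) = c * (ascPochhammer ℝ k).eval β := by
  simp [momentFunctional, Polynomial.lsum_apply, Polynomial.sum_monomial_index]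

theorem momentFunctional_X_pow (β : ℝ) (k : ℕ) :
    momentFunctional β (Polynomial.X ^ k) = (ascPochhammer ℝ k).eval β := by
  rw [Polynomial.X_pow_eq_monomial, momentFunctional_monomial, one_mul]

theorem momentFunctional_C_mul (β c : ℝ) (p : Polynomial ℝ) :
    momentFunctional β (Polynomial.C c * p) = c * momentFunctional β p := by
  rw [← Polynomial.smul_eq_C_mul, map_smul, smul_eq_mul]

section Laguerre

open Polynomial

/-- This is the contiguous relation `L_n^{(γ+1)} = L_n^{(γ)} + L_{n-1}^{(γ+1)}` with `γ = β + a -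
1`, derived from the recursion alone. At `n = 0` the truncated index `n - 1` is harmless because its
coefficient vanishes. -/
theorem signedLaguerre_shift (β : ℝ) (n : ℕ) : ∀ a,
    signedLaguerre β n (a + 1) =
      X * signedLaguerre β n a - C (n : ℝ) * signedLaguerre β (n - 1) (a + 1) := by
  induction n with
  | zero => intro a; simp [signedLaguerre, pow_succ']
  | succ n ih =>
    intro a
    have h1 := ih a
    have h2 := ih (a + 1)
    have h3 : C (n : ℝ) * signedLaguerre β (n - 1) (a + 1 + 1) = C (n : ℝ) *
        (signedLaguerre β n (a + 1) + C (β + a + n) * signedLaguerre β (n - 1) (a + 1)) := by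
      rcases n with _ | n
      · simp
      · rw [signedLaguerre, Nat.add_sub_cancel]
        push_cast
        rw [show β + (a + 1) + (n : ℝ) = β + a + (n + 1) by ring]
        ring
    rw [h3] at h2
    simp only [signedLaguerre, Nat.add_sub_cancel]
    rw [h2]
    have h4 : C (n : ℝ) * signedLaguerre β (n - 1) (a + 1) =
        X * signedLaguerre β n a - signedLaguerre β n (a + 1) := by rw [h1]; ring
    push_cast
    simp only [map_add, map_one]
    linear_combination (-C β - C (a : ℝ) - C (n : ℝ)) * h4

/-- The defining recursion and `signedLaguerre_shift`, both at `a = 0`, allow the polynomials with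
`a = 1` to be eliminated. -/
theorem signedLaguerre_three_term (β : ℝ) (n : ℕ) :
    signedLaguerre β (n + 1) 0 = X * signedLaguerre β n 0 -
      C (2 * n + β) * signedLaguerre β n 0 -
      C (n * (n - 1 + β)) * signedLaguerre β (n - 1) 0 := by
  have h := signedLaguerre_shift β n 0
  rcases n with _ | n
  · simp [signedLaguerre]
  · rw [Nat.add_sub_cancel] at h ⊢
    have h2 : signedLaguerre β n (0 + 1) = signedLaguerre β (n + 1) 0 +
        C (β + (0 : ℕ) + n) * signedLaguerre β n 0 := by rw [signedLaguerre]; ring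
    rw [signedLaguerre, h, h2]
    push_cast
    simp only [map_add, map_mul, map_sub, map_one, map_zero, map_ofNat]
    ring

/-- The polynomial `(-1)^n n! L_n^{(b - 1)}`. -/
noncomputable def laguerreSum (b : ℝ) (n : ℕ) : ℝ[X] :=
  ∑ k ∈ range (n + 1), C ((-1) ^ n * (ascPochhammer ℝ n).eval b *
    (ascPochhammer ℝ k).eval (-(n : ℝ)) / (k ! * (ascPochhammer ℝ k).eval b)) * X ^ k

/-- Valid for every `k`, since `(-n)_k = 0` once `k > n`. -/
theorem coeff_laguerreSum (b : ℝ) (n k : ℕ) :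
    (laguerreSum b n).coeff k = (-1) ^ n * (ascPochhammer ℝ n).eval b *
      (ascPochhammer ℝ k).eval (-(n : ℝ)) / (k ! * (ascPochhammer ℝ k).eval b) := by
  rw [laguerreSum, finsetSum_coeff]
  simp only [coeff_C_mul_X_pow]
  rw [sum_ite_eq]
  split_ifs with h
  · rfl
  · rw [ascPochhammer_eval_neg_coe_nat_of_lt (by simpa using h)]; simp

theorem ascPochhammer_eval_succ_left (n : ℕ) (b : ℝ) :
    (ascPochhammer ℝ (n + 1)).eval b = b * (ascPochhammer ℝ n).eval (b + 1) := by
  simp [ascPochhammer_succ_left]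

theorem laguerreSum_succ {b : ℝ} (hb : 0 < b) (n : ℕ) :
    laguerreSum b (n + 1) = X * laguerreSum (b + 1) n - C (b + n) * laguerreSum b n := by
  ext k
  have hn : (ascPochhammer ℝ (n + 1)).eval b = (ascPochhammer ℝ n).eval b * (b + n) :=
    ascPochhammer_succ_eval _ _
  rcases k with _ | k
  · simp only [coeff_sub, coeff_laguerreSum, mul_coeff_zero, coeff_X_zero, hn]
    simp [pow_succ]
    ring
  · have hk : (ascPochhammer ℝ (k + 1)).eval b ≠ 0 := (ascPochhammer_pos _ _ hb).ne'
    have h1 := ascPochhammer_eval_succ_left k b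
    have h2 := ascPochhammer_eval_succ_left n b
    have h3 := ascPochhammer_eval_succ_left k (-((n + 1 : ℕ) : ℝ))
    have h4 : (ascPochhammer ℝ (k + 1)).eval (-(n : ℝ)) = (ascPochhammer ℝ k).eval (-(n : ℝ)) *
      (-n + k) := ascPochhammer_succ_eval _ _
    rw [show -((n + 1 : ℕ) : ℝ) + 1 = -n by push_cast; ring] at h3
    have h5 : (ascPochhammer ℝ k).eval (b + 1) ≠ 0 := (ascPochhammer_pos _ _ (by linarith)).ne'
    have h6 : (k ! : ℝ) ≠ 0 := by positivity
    have h7 : (k : ℝ) + 1 ≠ 0 := by positivity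
    have h8 : (ascPochhammer ℝ n).eval (b + 1) = (ascPochhammer ℝ n).eval b * (b + n) / b := by
      rw [← hn, h2]; field_simp
    simp only [coeff_sub, coeff_C_mul, coeff_X_mul, coeff_laguerreSum, h3, h1, h4, hn, h8,
      Nat.factorial_succ]
    push_cast
    field_simp
    ring

theorem signedLaguerre_eq {β : ℝ} (hβ : 0 < β) (n : ℕ) : ∀ a : ℕ,
    signedLaguerre β n a = X ^ a * laguerreSum (β + a) n := by
  induction n with
  | zero => intro a; simp [signedLaguerre, laguerreSum]
  | succ n ih =>
    intro a
    rw [signedLaguerre, ih, ih, laguerreSum_succ (by positivity)]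
    push_cast
    rw [add_assoc β]
    ring_nf

theorem signedLaguerre_zero_right {α : ℝ} (hα : -1 < α) (n : ℕ) :
    signedLaguerre (α + 1) n 0 = C ((-1) ^ n * (n ! : ℝ)) * laguerre α n := by
  rw [signedLaguerre_eq (by linarith), pow_zero, one_mul, Nat.cast_zero, add_zero, laguerre,
    laguerreSum, mul_sum, mul_sum]
  refine sum_congr rfl fun k _ => ?_
  rw [← mul_assoc, ← mul_assoc, ← C_mul, ← C_mul]
  congr 2
  have h6 : (n ! : ℝ) ≠ 0 := by positivity
  field_simp

end Laguerre

/-! ### Gamma integrals and the moment functional -/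

section Integral

variable {α : ℝ}

theorem Gamma_add_natCast {b : ℝ} (hb : 0 < b) (k : ℕ) :
    Real.Gamma (b + k) = (ascPochhammer ℝ k).eval b * Real.Gamma b := by
  induction k with
  | zero => simp
  | succ k ih =>
    push_cast
    rw [← add_assoc, Real.Gamma_add_one (by positivity), ih, ascPochhammer_succ_eval]
    ring

/-- On monomials this is `Γ(α+1+k) = (α+1)_k Γ(α+1)`. Integrability is carried through the induction
because additivity of the integral requires it. -/
theorem integrableOn_and_integral_laguerre_weight (hα : -1 < α) (p : Polynomial ℝ) :
    IntegrableOn (fun x => x ^ α * Real.exp (-x) / Real.Gamma (α + 1) * p.eval x) (Set.Ioi 0) ∧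
      ∫ x in Set.Ioi (0 : ℝ), x ^ α * Real.exp (-x) / Real.Gamma (α + 1) * p.eval x =
        momentFunctional (α + 1) p := by
  have hβ : 0 < α + 1 := by linarith
  have hΓ := (Real.Gamma_pos_of_pos hβ).ne'
  induction p using Polynomial.induction_on' with
  | add p q hp hq =>
    simp only [Polynomial.eval_add, mul_add, map_add]
    exact ⟨hp.1.add hq.1, by rw [integral_add hp.1 hq.1, hp.2, hq.2]⟩
  | monomial k c =>
    have hs : 0 < α + 1 + k := by positivity
    have heq : Set.EqOn (fun x : ℝ => c / Real.Gamma (α + 1) *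
        (Real.exp (-x) * x ^ (α + 1 + k - 1)))
        (fun x => x ^ α * Real.exp (-x) / Real.Gamma (α + 1) *
          (Polynomial.monomial k c).eval x) (Set.Ioi 0) := by
      intro x hx
      have hx : 0 < x := hx
      simp only [Polynomial.eval_monomial]
      rw [show α + 1 + k - 1 = α + k by ring, Real.rpow_add hx, Real.rpow_natCast]
      ring
    constructor
    · exact IntegrableOn.congr_fun ((Real.GammaIntegral_convergent hs).const_mul _) heq
        measurableSet_Ioi
    · rw [← setIntegral_congr_fun measurableSet_Ioi heq, integral_const_mul,
        ← Real.Gamma_eq_integral hs, Gamma_add_natCast hβ, momentFunctional_monomial]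
      field_simp

theorem laguerreIntegrand_eq {m : ℕ} (n₀ : ℕ) (n : Fin m → ℕ) (x : ℝ) :
    laguerreIntegrand α n₀ n x = x ^ α * Real.exp (-x) / Real.Gamma (α + 1) *
      (Polynomial.X ^ n₀ * ∏ j, Polynomial.C ((n j) ! : ℝ) * laguerre α (n j)).eval x := by
  simp only [laguerreIntegrand, Polynomial.eval_mul, Polynomial.eval_pow, Polynomial.eval_X,
    Polynomial.eval_prod, Polynomial.eval_C]
  ring

theorem laguerreNumber_eq (hα : -1 < α) {m : ℕ} (n₀ : ℕ) (n : Fin m → ℕ) :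
    laguerreNumber α n₀ n = momentFunctional (α + 1)
      (Polynomial.X ^ n₀ * ∏ j, signedLaguerre (α + 1) (n j) 0) := by
  simp only [laguerreNumber, laguerreIntegrand_eq,
    (integrableOn_and_integral_laguerre_weight hα _).2, signedLaguerre_zero_right hα]
  rw [← momentFunctional_C_mul]
  congr 1
  simp only [Polynomial.C_mul, prod_mul_distrib, ← map_prod, prod_pow_eq_pow_sum]
  ring

end Integral

/-! ### The permutation sum as a moment -/

theorem card_subtype_option_of_pos {V : Type*} [Finite V] {P : Option V → Prop} (h : P none) :
    Nat.card {o // P o} = Nat.card {x : V // P (some x)} + 1 := by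
  classical
  have := Fintype.ofFinite V
  simp only [Nat.card_eq_fintype_card, Fintype.card_subtype]
  simp [card_filter, Fintype.sum_option, -sum_boole, h, add_comm]

theorem card_subtype_option_of_neg {V : Type*} [Finite V] {P : Option V → Prop} (h : ¬ P none) :
    Nat.card {o // P o} = Nat.card {x : V // P (some x)} := by
  classical
  have := Fintype.ofFinite V
  simp only [Nat.card_eq_fintype_card, Fintype.card_subtype]
  simp [card_filter, Fintype.sum_option, -sum_boole, h]

section cycleSum

variable {V W ι : Type*} [Fintype ι] (β : ℝ)

/-- The product of the polynomials `signedLaguerre β n a`, one for each colour, where `n` counts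
the marked and `a` the unmarked elements of that colour. -/
noncomputable def colourPoly (κ : V → ι) (U : V → Prop) : Polynomial ℝ :=
  ∏ i, signedLaguerre β (Nat.card {b // U b ∧ κ b = i}) (Nat.card {b // ¬ U b ∧ κ b = i})

theorem colourPoly_congr (e : V ≃ W) (κ : W → ι) (U : W → Prop) :
    colourPoly β (κ ∘ e) (U ∘ e) = colourPoly β κ U := by
  refine prod_congr rfl fun i _ => ?_
  congr 1 <;> exact Nat.card_congr (e.subtypeEquiv fun _ => Iff.rfl)

variable [Fintype V]

theorem colourPoly_unmarked (κ : V → ι) :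
    colourPoly β κ (fun _ => False) = Polynomial.X ^ Fintype.card V := by
  classical
  have h0 : ∀ i, Nat.card {b // False ∧ κ b = i} = 0 := fun i => by simp
  simp only [colourPoly, h0, signedLaguerre, not_false_iff, true_and]
  rw [prod_pow_eq_pow_sum, ← card_univ,
    card_eq_sum_card_fiberwise (f := κ) (t := univ) fun _ _ => mem_coe.2 (mem_univ _)]
  simp only [Nat.card_eq_fintype_card, Fintype.card_subtype]

/-- Only the factor of the colour of `none` changes, and there the identity is the recursion
defining `signedLaguerre`. -/
theorem colourPoly_option (κ : Option V → ι) (U : Option V → Prop) (h : U none) :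
    colourPoly β κ U = colourPoly β κ (fun b => b ≠ none ∧ U b) -
      Polynomial.C (β + Nat.card {x : V // κ (some x) = κ none}) *
        colourPoly β (κ ∘ some) (U ∘ some) := by
  classical
  set j := κ none with hj
  have hc : Nat.card {x : V // κ (some x) = j} = Nat.card {x : V // ¬ U (some x) ∧ κ (some x) = j} +
      Nat.card {x : V // U (some x) ∧ κ (some x) = j} := by
    simp only [Nat.card_eq_fintype_card, Fintype.card_subtype]
    rw [← card_filter_add_card_filter_not (fun x => ¬ U (some x)), filter_filter, filter_filter]
    simp [and_comm]
  simp only [colourPoly, ← mul_prod_erase univ _ (mem_univ j)]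
  have e1 : ∀ i ∈ univ.erase j, signedLaguerre β (Nat.card {b : Option V // U b ∧ κ b = i})
      (Nat.card {b : Option V // ¬ U b ∧ κ b = i}) =
      signedLaguerre β (Nat.card {b : V // (U ∘ some) b ∧ (κ ∘ some) b = i})
        (Nat.card {b : V // ¬ (U ∘ some) b ∧ (κ ∘ some) b = i}) := fun i hi => by
    have : j ≠ i := (ne_of_mem_erase hi).symm
    rw [card_subtype_option_of_neg (by tauto), card_subtype_option_of_neg (by tauto)]
    rfl
  have e2 : ∀ i ∈ univ.erase j,
      signedLaguerre β (Nat.card {b : Option V // (b ≠ none ∧ U b) ∧ κ b = i})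
        (Nat.card {b : Option V // ¬ (b ≠ none ∧ U b) ∧ κ b = i}) =
      signedLaguerre β (Nat.card {b : V // (U ∘ some) b ∧ (κ ∘ some) b = i})
        (Nat.card {b : V // ¬ (U ∘ some) b ∧ (κ ∘ some) b = i}) := fun i hi => by
    have : j ≠ i := (ne_of_mem_erase hi).symm
    rw [card_subtype_option_of_neg (by tauto), card_subtype_option_of_neg (by tauto)]
    simp
  rw [prod_congr rfl e1, prod_congr rfl e2, ← mul_assoc, ← sub_mul]
  congr 1
  rw [card_subtype_option_of_pos ⟨h, rfl⟩, card_subtype_option_of_neg (by tauto),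
    card_subtype_option_of_neg (P := fun b => (b ≠ none ∧ U b) ∧ κ b = j) (by tauto),
    card_subtype_option_of_pos (P := fun b => ¬ (b ≠ none ∧ U b) ∧ κ b = j) (by tauto), hc,
    signedLaguerre]
  simp [add_assoc]

theorem cycleSum_eq_momentFunctional (κ : V → ι) (U : V → Prop) :
    cycleSum β κ U = momentFunctional β (colourPoly β κ U) := by
  -- The type varies in the induction on marked points: one term of the recursion keeps the chosen
  -- point unmarked, the other deletes it.
  suffices ∀ (N : ℕ) (V : Type _) [Fintype V] (κ : V → ι) (U : V → Prop),
      Nat.card {b // U b} = N → cycleSum β κ U = momentFunctional β (colourPoly β κ U) from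
    this _ V κ U rfl
  intro N
  induction N with
  | zero =>
    intro V _ κ U hU
    obtain rfl : U = fun _ => False := by
      funext b
      have := Finite.card_eq_zero_iff.1 hU
      exact eq_false fun h => this.false ⟨b, h⟩
    rw [cycleSum_unmarked, colourPoly_unmarked, momentFunctional_X_pow]
  | succ N ih =>
    intro V _ κ U hU
    classical
    have : Nonempty {b // U b} := (Finite.card_pos_iff).1 (by omega)
    obtain ⟨b, hb⟩ := this
    let e := Equiv.optionSubtypeNe b
    have he : (U ∘ e) none := hb
    have hU' : Nat.card {x // (U ∘ e) (some x)} = N := by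
      have h1 : Nat.card {x // (U ∘ e) x} = N + 1 := by
        rw [← hU]
        exact Nat.card_congr (e.subtypeEquiv fun _ => Iff.rfl)
      rw [card_subtype_option_of_pos he] at h1
      omega
    rw [← cycleSum_congr β e, ← colourPoly_congr β e, cycleSum_option β _ _ he,
      colourPoly_option β _ _ he, map_sub, momentFunctional_C_mul, ih, ih]
    · exact hU'
    · rw [card_subtype_option_of_neg (by tauto)]
      simpa using hU'

end cycleSum

/-- Box `0` has only unmarked points and the others only marked ones, so `colourPoly` becomes the
integrand's polynomial. -/
theorem laguerreNumber_eq_sum {α : ℝ} (hα : -1 < α) {m : ℕ} (n₀ : ℕ) (n : Fin m → ℕ) :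
    laguerreNumber α n₀ n = ∑ π ∈ restrictedPerms n₀ n, (α + 1) ^ cyc π := by
  classical
  have h := cycleSum_eq_momentFunctional (α + 1) (fun b : Boxes n₀ n => b.1) (fun b => b.1 ≠ 0)
  rw [cycleSum_eq_sum] at h
  rw [laguerreNumber_eq hα, restrictedPerms, sum_filter, h]
  congr 1
  rw [colourPoly, Fin.prod_univ_succ]
  have c : ∀ i, Nat.card {b : Boxes n₀ n // b.1 = i} = (Fin.cons n₀ n : Fin (m + 1) → ℕ) i := by
    intro i
    rw [Nat.card_congr (Equiv.sigmaSubtype i), Nat.card_fin]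
  have c0 : Nat.card {b : Boxes n₀ n // b.1 ≠ 0 ∧ b.1 = 0} = 0 := by
    rw [Finite.card_eq_zero_iff]
    exact ⟨fun b => b.2.1 b.2.2⟩
  have c1 : Nat.card {b : Boxes n₀ n // ¬ b.1 ≠ 0 ∧ b.1 = 0} = n₀ :=
    (Nat.card_congr (Equiv.subtypeEquivRight fun _ =>
      and_iff_right_of_imp fun h => not_ne_iff.2 h)).trans (c 0)
  have c2 : ∀ j : Fin m, Nat.card {b : Boxes n₀ n // b.1 ≠ 0 ∧ b.1 = j.succ} = n j := fun j =>
    (Nat.card_congr (Equiv.subtypeEquivRight fun b =>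
      and_iff_right_of_imp fun h => h ▸ Fin.succ_ne_zero j)).trans (c j.succ)
  have c3 : ∀ j : Fin m, Nat.card {b : Boxes n₀ n // ¬ b.1 ≠ 0 ∧ b.1 = j.succ} = 0 := fun j => by
    rw [Finite.card_eq_zero_iff]
    exact ⟨fun b => b.2.1 fun h => Fin.succ_ne_zero j (b.2.2.symm.trans h)⟩
  rw [c0, c1, signedLaguerre]
  simp only [c2, c3]

/-! ### Differential equation of the base polynomial -/

section basePoly

open MvPolynomial

variable {m : ℕ}

/-- The sum of `(1 - |t|) ∏_{i ∈ t} x_i` over the subsets `t` of `s`. -/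
noncomputable def weightedSubsetSum (s : Finset (Fin m)) : MvPolynomial (Fin (m + 1)) ℝ :=
  ∑ t ∈ s.powerset, (1 - (#t : MvPolynomial (Fin (m + 1)) ℝ)) * ∏ i ∈ t, X i.succ

theorem weightedSubsetSum_insert {s : Finset (Fin m)} {j : Fin m} (hj : j ∉ s) :
    weightedSubsetSum (insert j s) = (1 + X j.succ) * weightedSubsetSum s -
      X j.succ * ∏ i ∈ s, (1 + X i.succ) := by
  rw [weightedSubsetSum, sum_powerset_insert hj, prod_one_add, weightedSubsetSum, mul_sum, mul_sum,
    ← sum_sub_distrib, ← sum_add_distrib]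
  refine sum_congr rfl fun t ht => ?_
  have hjt : j ∉ t := fun h => hj (mem_powerset.1 ht h)
  rw [card_insert_of_notMem hjt, prod_insert hjt]
  push_cast
  ring

theorem basePoly_eq_weightedSubsetSum :
    basePoly m = weightedSubsetSum univ - X 0 * ∏ j : Fin m, (1 + X j.succ) := by
  have h : ∀ k, ∑ t ∈ powersetCard k (univ : Finset (Fin m)),
      (1 - (#t : MvPolynomial (Fin (m + 1)) ℝ)) * ∏ i ∈ t, X i.succ =
      -(C ((k : ℝ) - 1) * rename Fin.succ (esymm (Fin m) ℝ k)) := by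
    intro k
    simp only [esymm, map_sum, map_prod, rename_X]
    rw [mul_sum, ← sum_neg_distrib]
    refine sum_congr rfl fun t ht => ?_
    rw [(mem_powersetCard.1 ht).2]
    simp only [map_sub, map_natCast, map_one]
    ring
  rw [weightedSubsetSum, sum_powerset, sum_congr rfl fun k _ => h k, sum_neg_distrib, basePoly]
  -- The term `k = 0` supplies the `-1` and the term `k = 1` vanishes.
  have h2 : ∑ k ∈ range (#(univ : Finset (Fin m)) + 1),
      C ((k : ℝ) - 1) * rename Fin.succ (esymm (Fin m) ℝ k) =
      ∑ k ∈ Icc 2 m, C ((k : ℝ) - 1) * rename Fin.succ (esymm (Fin m) ℝ k) - 1 := by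
    rw [card_univ, Fintype.card_fin, sum_range_succ', ← Ico_add_one_right_eq_Icc,
      sum_Ico_eq_sum_range]
    rcases m with _ | m
    · simp
    · rw [sum_range_succ']
      simp [add_comm, add_left_comm, sub_eq_add_neg]
  rw [h2]
  ring

theorem pderiv_prod_one_add_X {s : Finset (Fin m)} {j : Fin m} (hj : j ∉ s) :
    pderiv j.succ (∏ i ∈ s, (1 + X i.succ) : MvPolynomial (Fin (m + 1)) ℝ) = 0 := by
  induction s using Finset.induction_on with
  | empty => simp
  | insert a s ha ih =>
    rw [mem_insert, not_or] at hj
    rw [prod_insert ha, Derivation.leibniz, ih hj.2, map_add, Derivation.map_one_eq_zero,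
      pderiv_X_of_ne (by simpa using Ne.symm hj.1)]
    simp

theorem pderiv_weightedSubsetSum {s : Finset (Fin m)} {j : Fin m} (hj : j ∉ s) :
    pderiv j.succ (weightedSubsetSum s) = 0 := by
  induction s using Finset.induction_on with
  | empty => simp [weightedSubsetSum]
  | insert a s ha ih =>
    rw [mem_insert, not_or] at hj
    rw [weightedSubsetSum_insert ha, map_sub, Derivation.leibniz, Derivation.leibniz, ih hj.2,
      map_add, Derivation.map_one_eq_zero, pderiv_X_of_ne (by simpa using Ne.symm hj.1),
      pderiv_prod_one_add_X hj.2]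
    simp

theorem pderiv_zero_prod_one_add_X (s : Finset (Fin m)) :
    pderiv 0 (∏ i ∈ s, (1 + X i.succ) : MvPolynomial (Fin (m + 1)) ℝ) = 0 := by
  induction s using Finset.induction_on with
  | empty => simp
  | insert a s ha ih =>
    rw [prod_insert ha, Derivation.leibniz, ih, map_add, Derivation.map_one_eq_zero,
      pderiv_X_of_ne (Fin.succ_ne_zero a)]
    simp

theorem pderiv_zero_weightedSubsetSum (s : Finset (Fin m)) :
    pderiv 0 (weightedSubsetSum s) = 0 := by
  induction s using Finset.induction_on with
  | empty => simp [weightedSubsetSum]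
  | insert a s ha ih =>
    rw [weightedSubsetSum_insert ha, map_sub, Derivation.leibniz, Derivation.leibniz, ih,
      map_add, Derivation.map_one_eq_zero, pderiv_X_of_ne (Fin.succ_ne_zero a),
      pderiv_zero_prod_one_add_X]
    simp

/-- The polynomial is `(1 + x_j) W - x_j Q - x_0 (1 + x_j) Q` with `W` and `Q` free of `x_0` and
`x_j`; both sides are then explicit. -/
theorem pderiv_basePoly (j : Fin m) :
    (1 + X j.succ) ^ 2 * pderiv j.succ (basePoly m) =
      pderiv 0 (basePoly m) + (1 + X j.succ) * basePoly m := by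
  have hj := notMem_erase j univ
  have h1 := pderiv_weightedSubsetSum hj
  have h2 := pderiv_prod_one_add_X hj
  have h3 := pderiv_zero_weightedSubsetSum (univ.erase j)
  have h4 := pderiv_zero_prod_one_add_X (univ.erase j)
  rw [basePoly_eq_weightedSubsetSum, ← insert_erase (mem_univ j), weightedSubsetSum_insert hj,
    prod_insert hj]
  simp only [map_sub, map_add, Derivation.leibniz, h1, h2, h3, h4, pderiv_X_self,
    Derivation.map_one_eq_zero, pderiv_X_of_ne (Fin.succ_ne_zero j),
    pderiv_X_of_ne (Fin.succ_ne_zero j).symm, smul_eq_mul]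
  ring

theorem pderiv_basePoly_pow (j : Fin m) (N : ℕ) :
    (1 + X j.succ) ^ 2 * pderiv j.succ (basePoly m ^ N) =
      pderiv 0 (basePoly m ^ N) + C (N : ℝ) * ((1 + X j.succ) * basePoly m ^ N) := by
  rcases N with _ | N
  · simp
  · simp only [Derivation.leibniz_pow, nsmul_eq_mul, smul_eq_mul, Nat.add_sub_cancel, map_natCast]
    linear_combination ((N + 1 : ℕ) : MvPolynomial (Fin (m + 1)) ℝ) * basePoly m ^ N *
      pderiv_basePoly j

/-! ### The recurrence, its uniqueness, and powers with natural exponent -/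

/-- The product of the factorials of the exponents of a monomial. -/
def exponentFactorial {σ : Type*} [Fintype σ] (d : σ →₀ ℕ) : ℝ := ∏ i, (((d i) ! : ℕ) : ℝ)

section exponentFactorial

variable {σ : Type*} [Fintype σ]

theorem exponentFactorial_ne_zero (d : σ →₀ ℕ) : exponentFactorial d ≠ 0 :=
  prod_ne_zero_iff.2 fun i _ => by positivity

theorem exponentFactorial_add_single (d : σ →₀ ℕ) (i : σ) :
    exponentFactorial (d + Finsupp.single i 1) = (d i + 1) * exponentFactorial d := by
  classical
  rw [exponentFactorial, exponentFactorial, ← mul_prod_erase _ _ (mem_univ i),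
    ← mul_prod_erase univ (fun i => (((d i) ! : ℕ) : ℝ)) (mem_univ i), ← mul_assoc]
  congr 1
  · simp [Nat.factorial_succ]
  · refine prod_congr rfl fun k hk => ?_
    simp [Finsupp.single_eq_of_ne (ne_of_mem_erase hk)]

end exponentFactorial

/-- The recurrence satisfied by the numbers `A(d)`, in the form `A(d + e_j) = …`. -/
def IsLaguerreRecurrence (β : ℝ) (a : (Fin (m + 1) →₀ ℕ) → ℝ) : Prop :=
  ∀ (j : Fin m) (d : Fin (m + 1) →₀ ℕ),
    a (d + Finsupp.single j.succ 1) = a (d + Finsupp.single 0 1) - (2 * d j.succ + β) * a d -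
      d j.succ * (d j.succ - 1 + β) * a (d - Finsupp.single j.succ 1)

/-- Every index on the right of the recurrence has a smaller sum of its last `m` entries than `d +
e_j`; the entry at `0` may grow freely. -/
theorem IsLaguerreRecurrence.ext {β : ℝ} {a b : (Fin (m + 1) →₀ ℕ) → ℝ}
    (ha : IsLaguerreRecurrence β a) (hb : IsLaguerreRecurrence β b)
    (h : ∀ n, a (Finsupp.single 0 n) = b (Finsupp.single 0 n)) : a = b := by
  suffices ∀ (N : ℕ) (d : Fin (m + 1) →₀ ℕ), ∑ j : Fin m, d j.succ ≤ N → a d = b d from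
    funext fun d => this _ d le_rfl
  intro N
  induction N with
  | zero =>
    intro d hd
    have : d = Finsupp.single 0 (d 0) := by
      ext i
      refine Fin.cases (by simp) (fun j => ?_) i
      have := (sum_eq_zero_iff.1 (Nat.le_zero.1 hd)) j (mem_univ j)
      simp [this]
    rw [this, h]
  | succ N ih =>
    intro d hd
    by_cases h0 : ∑ j : Fin m, d j.succ ≤ N
    · exact ih d h0
    obtain ⟨j, -, hj⟩ := exists_ne_zero_of_sum_ne_zero (show ∑ j : Fin m, d j.succ ≠ 0 by omega)
    obtain ⟨d, rfl⟩ : ∃ d', d = d' + Finsupp.single j.succ 1 :=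
      ⟨d - Finsupp.single j.succ 1, (tsub_add_cancel_of_le
        (Finsupp.single_le_iff.2 (Nat.one_le_iff_ne_zero.2 hj))).symm⟩
    have hs : ∑ i : Fin m, d i.succ ≤ N := by
      simpa [sum_add_distrib, Finsupp.single_apply] using hd
    have hs' : ∑ i : Fin m, (d - Finsupp.single j.succ 1 : Fin (m + 1) →₀ ℕ) i.succ ≤ N :=
      (sum_le_sum fun i _ => tsub_le_self).trans hs
    rw [ha, hb, ih d hs, ih _ hs', ih (d + Finsupp.single 0 1)]
    simpa [Finsupp.single_apply, (Fin.succ_ne_zero _).symm] using hs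

theorem coeff_basePoly_pow_recurrence (N : ℕ) :
    IsLaguerreRecurrence (-(N : ℝ)) fun d => coeff d (basePoly m ^ N) * exponentFactorial d := by
  intro j d
  have h := congrArg (coeff d) (pderiv_basePoly_pow j N)
  have e : (1 + X j.succ : MvPolynomial (Fin (m + 1)) ℝ) ^ 2 * pderiv j.succ (basePoly m ^ N) =
      pderiv j.succ (basePoly m ^ N) + X j.succ * pderiv j.succ (basePoly m ^ N) +
      X j.succ * pderiv j.succ (basePoly m ^ N) +
      X j.succ * (X j.succ * pderiv j.succ (basePoly m ^ N)) := by ring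
  rw [e, add_mul, one_mul] at h
  simp only [exponentFactorial_add_single]
  by_cases hd : d j.succ = 0
  · have hs : j.succ ∉ d.support := by simpa using hd
    simp only [coeff_add, coeff_X_mul', coeff_pderiv, coeff_C_mul, hs, if_false] at h
    simp only [hd, Nat.cast_zero] at h ⊢
    linear_combination exponentFactorial d * h
  · obtain ⟨d, rfl⟩ : ∃ d', d = d' + Finsupp.single j.succ 1 :=
      ⟨d - Finsupp.single j.succ 1, (tsub_add_cancel_of_le
        (Finsupp.single_le_iff.2 (Nat.one_le_iff_ne_zero.2 hd))).symm⟩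
    -- The Euler operator `x_j ∂_j` multiplies the coefficient at `d` by `d_j`, also when `d_j = 0`.
    have h5 : coeff d (X j.succ * pderiv j.succ (basePoly m ^ N)) =
        coeff d (basePoly m ^ N) * d j.succ := by
      rw [coeff_X_mul']
      split_ifs with hs
      · have hs : 1 ≤ d j.succ := Nat.one_le_iff_ne_zero.2 (by simpa using hs)
        rw [coeff_pderiv, tsub_add_cancel_of_le (Finsupp.single_le_iff.2 hs)]
        simp [Nat.cast_sub hs]
      · have hs : d j.succ = 0 := by simpa using hs
        simp [hs]
    simp only [coeff_add, coeff_C_mul] at h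
    rw [add_comm d, coeff_X_mul, coeff_X_mul, coeff_X_mul, h5, add_comm _ d] at h
    simp only [coeff_pderiv] at h
    simp only [exponentFactorial_add_single, add_tsub_cancel_right]
    simp only [Finsupp.add_apply, Finsupp.single_eq_same] at h ⊢
    push_cast at h ⊢
    linear_combination ((d j.succ : ℝ) + 1) * exponentFactorial d * h

theorem map_basePoly_of_map_X_succ_eq_zero {R : Type*} [CommRing R]
    (f : MvPolynomial (Fin (m + 1)) ℝ →+* R) (hf : ∀ j : Fin m, f (X j.succ) = 0) :
    f (basePoly m) = 1 - f (X 0) := by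
  have h : ∀ s : Finset (Fin m), f (weightedSubsetSum s) = 1 := by
    intro s
    induction s using Finset.induction_on with
    | empty => simp [weightedSubsetSum]
    | insert a s ha ih =>
      rw [weightedSubsetSum_insert ha, map_sub, map_mul, map_mul, map_add, hf, ih]
      simp
  rw [basePoly_eq_weightedSubsetSum, map_sub, h, map_mul, map_prod]
  simp [hf]

/-- Setting `x_1 = ⋯ = x_m = 0` leaves `(1 - x_0)^N`, and `n! (-1)^n binom(N, n) = (-N)_n`. -/
theorem coeff_single_zero_basePoly_pow (N n : ℕ) :
    coeff (Finsupp.single 0 n) (basePoly m ^ N) *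
        exponentFactorial (Finsupp.single (0 : Fin (m + 1)) n) =
      (ascPochhammer ℝ n).eval (-(N : ℝ)) := by
  have h1 : coeff (Finsupp.single 0 n) (basePoly m ^ N) =
      ((1 - Polynomial.X : Polynomial ℝ) ^ N).coeff n := by
    have hs : Finsupp.single (0 : Fin (m + 1)) n = Finsupp.cons n 0 := by
      ext i
      refine Fin.cases ?_ (fun j => ?_) i
      · simp
      · rw [Finsupp.cons_succ]; simp
    let f : MvPolynomial (Fin (m + 1)) ℝ →+* Polynomial ℝ :=
      (Polynomial.mapRingHom constantCoeff).comp (finSuccEquiv ℝ m).toRingEquiv.toRingHom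
    have hf : f (basePoly m) = 1 - Polynomial.X := by
      rw [map_basePoly_of_map_X_succ_eq_zero f fun j => ?_]
      · simp [f, finSuccEquiv_X_zero]
      · simp [f, finSuccEquiv_X_succ]
    rw [hs, ← finSuccEquiv_coeff_coeff, ← hf, ← map_pow]
    simp [f, constantCoeff_eq, -map_pow]
  have h2 : (1 - Polynomial.X : Polynomial ℝ) ^ N =
      ((1 + Polynomial.X : Polynomial ℝ) ^ N).comp (Polynomial.C (-1) * Polynomial.X) := by
    simp [sub_eq_add_neg]
  have h3 : exponentFactorial (Finsupp.single (0 : Fin (m + 1)) n) = n ! := by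
    simp [exponentFactorial, Fin.prod_univ_succ]
  rw [h1, h2, h3, Polynomial.comp_C_mul_X_coeff, Polynomial.coeff_one_add_X_pow,
    ascPochhammer_eval_neg_eq_descPochhammer, descPochhammer_eval_eq_descFactorial,
    Nat.descFactorial_eq_factorial_mul_choose]
  push_cast
  ring

end basePoly

/-! ### Coefficients of formal powers are polynomial in the exponent -/

section formalRpow

open PowerSeries

variable {σ : Type*} {F : MvPowerSeries σ ℝ}

theorem formalRpow_natCast (hF : HasSubst (F - 1)) (N : ℕ) : formalRpow F N = F ^ N := by
  rw [formalRpow, binomialSeries_nat, ← coe_substAlgHom hF, map_pow, map_add, map_one,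
    coe_substAlgHom, subst_X hF, add_sub_cancel]

theorem exists_polynomial_eval_eq_choose (k : ℕ) :
    ∃ Q : Polynomial ℝ, ∀ r : ℝ, Ring.choose r k = Q.eval r := by
  refine ⟨Polynomial.C ((k ! : ℝ)⁻¹) * descPochhammer ℝ k, fun r => ?_⟩
  have h := Ring.descPochhammer_eq_factorial_smul_choose r k
  rw [Polynomial.eval_mul, Polynomial.eval_C, ← descPochhammer_map (algebraMap ℤ ℝ),
    Polynomial.eval_map_algebraMap, Polynomial.aeval_eq_smeval, h, nsmul_eq_mul,
    inv_mul_cancel_left₀ (by positivity)]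

theorem exists_polynomial_eval_eq_coeff_formalRpow (hF : HasSubst (F - 1)) (d : σ →₀ ℕ) :
    ∃ Q : Polynomial ℝ, ∀ r : ℝ, MvPowerSeries.coeff d (formalRpow F r) = Q.eval r := by
  choose Q hQ using exists_polynomial_eval_eq_choose
  -- The all-ones series yields one finite set of `k`, independent of `r`, outside which `(F - 1)^k`
  -- has no coefficient at `d`.
  have hfin := coeff_subst_finite hF (PowerSeries.mk fun _ => (1 : ℝ)) d
  refine ⟨∑ k ∈ hfin.toFinset, Polynomial.C (MvPowerSeries.coeff d ((F - 1) ^ k)) * Q k,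
    fun r => ?_⟩
  rw [formalRpow, coeff_subst hF, finsum_eq_sum_of_support_subset (s := hfin.toFinset)]
  · rw [Polynomial.eval_finsetSum]
    refine sum_congr rfl fun k _ => ?_
    rw [binomialSeries_coeff, Polynomial.eval_mul, Polynomial.eval_C, hQ]
    simp [mul_comm]
  · intro k hk
    simp only [Set.Finite.coe_toFinset, Function.mem_support, coeff_mk, one_smul] at hk ⊢
    exact right_ne_zero_of_smul hk

end formalRpow

/-! ### Real exponents and the generating function -/

theorem polynomial_eq_of_eval_natCast {P Q : Polynomial ℝ}
    (h : ∀ N : ℕ, P.eval (N : ℝ) = Q.eval (N : ℝ)) : P = Q :=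
  Polynomial.eq_of_infinite_eval_eq P Q <|
    (Set.infinite_range_of_injective Nat.cast_injective).mono <| by
      rintro _ ⟨N, rfl⟩
      exact h N

section

variable {m : ℕ}

theorem coeff_formalRpow_basePoly_natCast (N : ℕ) (d : Fin (m + 1) →₀ ℕ) :
    MvPowerSeries.coeff d (formalRpow (basePoly m : MvPowerSeries (Fin (m + 1)) ℝ) N) =
      MvPolynomial.coeff d (basePoly m ^ N) := by
  rw [formalRpow_natCast (hasSubst_basePoly m), ← MvPolynomial.coe_pow, MvPolynomial.coeff_coe]

/-- For fixed `j` and `d` both sides are polynomials in `r` that agree at every natural number. -/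
theorem coeff_formalRpow_recurrence (r : ℝ) :
    IsLaguerreRecurrence (-r) fun d : Fin (m + 1) →₀ ℕ => MvPowerSeries.coeff d
      (formalRpow (basePoly m : MvPowerSeries (Fin (m + 1)) ℝ) r) * exponentFactorial d := by
  intro j d
  choose Q hQ using exists_polynomial_eval_eq_coeff_formalRpow (hasSubst_basePoly m)
  have h := polynomial_eq_of_eval_natCast
    (P := Q (d + Finsupp.single j.succ 1) *
      Polynomial.C (exponentFactorial (d + Finsupp.single j.succ 1)))
    (Q := Q (d + Finsupp.single 0 1) *
        Polynomial.C (exponentFactorial (d + Finsupp.single 0 1)) -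
      (2 * Polynomial.C (d j.succ : ℝ) + -Polynomial.X) *
        (Q d * Polynomial.C (exponentFactorial d)) -
      Polynomial.C (d j.succ : ℝ) * (Polynomial.C (d j.succ : ℝ) - 1 + -Polynomial.X) *
        (Q (d - Finsupp.single j.succ 1) *
          Polynomial.C (exponentFactorial (d - Finsupp.single j.succ 1)))) fun N => by
      have := coeff_basePoly_pow_recurrence N j d
      simpa [← hQ, coeff_formalRpow_basePoly_natCast] using this
  simpa [hQ] using congrArg (Polynomial.eval r) h

theorem coeff_single_zero_formalRpow (r : ℝ) (n : ℕ) :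
    MvPowerSeries.coeff (Finsupp.single 0 n)
      (formalRpow (basePoly m : MvPowerSeries (Fin (m + 1)) ℝ) r) *
        exponentFactorial (Finsupp.single (0 : Fin (m + 1)) n) =
      (ascPochhammer ℝ n).eval (-r) := by
  choose Q hQ using exists_polynomial_eval_eq_coeff_formalRpow (hasSubst_basePoly m)
  have h := polynomial_eq_of_eval_natCast
    (P := Q (Finsupp.single 0 n) *
      Polynomial.C (exponentFactorial (Finsupp.single (0 : Fin (m + 1)) n)))
    (Q := (ascPochhammer ℝ n).comp (-Polynomial.X)) fun N => by
      have := coeff_single_zero_basePoly_pow (m := m) N n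
      simpa [← hQ, coeff_formalRpow_basePoly_natCast] using this
  simpa [hQ] using congrArg (Polynomial.eval r) h

/-- The three-term relation is applied to the `j`-th factor; its multiplication by `X` is absorbed
as a unit increase of `n₀`. -/
theorem laguerreNumber_recurrence {α : ℝ} (hα : -1 < α) :
    IsLaguerreRecurrence (α + 1) fun d : Fin (m + 1) →₀ ℕ =>
      laguerreNumber α (d 0) fun j => d j.succ := by
  intro j d
  simp only [laguerreNumber_eq hα]
  rw [← momentFunctional_C_mul, ← momentFunctional_C_mul, ← map_sub, ← map_sub]
  congr 1
  have h1 : ∀ i ∈ univ.erase j, signedLaguerre (α + 1) ((d + Finsupp.single j.succ 1 : Fin (m + 1) →₀ ℕ) i.succ) 0 =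
      signedLaguerre (α + 1) (d i.succ) 0 := fun i hi => by
    simp [(ne_of_mem_erase hi).symm]
  have h2 : ∀ i ∈ univ.erase j,
      signedLaguerre (α + 1) ((d - Finsupp.single j.succ 1 : Fin (m + 1) →₀ ℕ) i.succ) 0 =
      signedLaguerre (α + 1) (d i.succ) 0 := fun i hi => by
    simp [(ne_of_mem_erase hi).symm]
  have h3 : ∀ i : Fin m, (d + Finsupp.single 0 1 : Fin (m + 1) →₀ ℕ) i.succ = d i.succ := fun i => by
    simp
  have h4 : (d + Finsupp.single j.succ 1 : Fin (m + 1) →₀ ℕ) 0 = d 0 := by simp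
  have h5 : (d - Finsupp.single j.succ 1 : Fin (m + 1) →₀ ℕ) 0 = d 0 := by simp
  have h6 : (d + Finsupp.single 0 1 : Fin (m + 1) →₀ ℕ) 0 = d 0 + 1 := by simp
  have h7 : (d + Finsupp.single j.succ 1 : Fin (m + 1) →₀ ℕ) j.succ = d j.succ + 1 := by simp
  have h8 : (d - Finsupp.single j.succ 1 : Fin (m + 1) →₀ ℕ) j.succ = d j.succ - 1 := by simp
  simp only [h3, h4, h5, h6]
  simp only [← mul_prod_erase univ _ (mem_univ j)]
  rw [prod_congr rfl h1, prod_congr rfl h2, h7, h8, signedLaguerre_three_term]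
  ring

theorem laguerreNumber_single_zero {α : ℝ} (hα : -1 < α) (n : ℕ) :
    laguerreNumber α (Finsupp.single (0 : Fin (m + 1)) n 0)
      (fun j : Fin m => Finsupp.single (0 : Fin (m + 1)) n j.succ) =
      (ascPochhammer ℝ n).eval (α + 1) := by
  simp [laguerreNumber_eq hα, signedLaguerre, momentFunctional_X_pow]

theorem expGenFun_laguerreNumber {α : ℝ} (hα : -1 < α) :
    expGenFun (m := m) (laguerreNumber α) =
      formalRpow (basePoly m : MvPowerSeries (Fin (m + 1)) ℝ) (-α - 1) := by
  have h := (laguerreNumber_recurrence (m := m) hα).ext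
    (by simpa [add_comm] using coeff_formalRpow_recurrence (m := m) (-α - 1)) fun n => by
      rw [laguerreNumber_single_zero hα, coeff_single_zero_formalRpow]
      congr 1
      ring
  ext d
  rw [eq_comm, ← mul_div_cancel_right₀ (MvPowerSeries.coeff d _) (exponentFactorial_ne_zero d)]
  exact congrArg (· / exponentFactorial d) (congrFun h d).symm

end

theorem mainTheorem8 (m : ℕ) (α : ℝ) (hα : -1 < α) :
    (∀ (n₀ : ℕ) (n : Fin m → ℕ),
      IntegrableOn (laguerreIntegrand α n₀ n) (Set.Ioi (0 : ℝ))) ∧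
    expGenFun (m := m) (laguerreNumber α) =
      formalRpow (basePoly m : MvPowerSeries (Fin (m + 1)) ℝ) (-α - 1) ∧
    (∀ (n₀ : ℕ) (n : Fin m → ℕ),
      laguerreNumber α n₀ n = ∑ π ∈ restrictedPerms n₀ n, (α + 1) ^ cyc π) := by
  refine ⟨fun n₀ n => ?_, expGenFun_laguerreNumber hα, laguerreNumber_eq_sum hα⟩
  rw [funext (laguerreIntegrand_eq n₀ n)]
  exact (integrableOn_and_integral_laguerre_weight hα _).1
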